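/- **Conventions.** All vectors are real. For a finite set $X$, a vector space $\mathcal V_X$ on $X$ is a subspace of $\mathbb R^X$; $\mathcal V_X^\perp$ is its orthogonal complement for the dot product. For $Y\subseteq X$ put $\mathcal V_X\circ Y=\{f|_Y: f\in\mathcal V_X\}$ and $\mathcal V_X\times Y=\{f|_Y: f\in\mathcal V_X,\ f|_{X-Y}=0\}$. A representative matrix of $\mathcal V_X$ has independent rows spanning $\mathcal V_X$; a set of columns of $\mathcal V_X$ is independent if it is so in a representative matrix; a column base is a maximal independent set of columns, a column cobase is the complement of a column base. $\mathcal V_X$ is *over $\mathbb Q$* if it has a representative matrix with rational entries. For a finite edge set $Q$, $Q'$ and $Q''$ are disjoint copies of $Q$ (voltage and current variables). A space $\mathcal V_{Q'Q''}$ is *Dirac* if interchanging $Q'$ and $Q''$ turns it into $\mathcal V_{Q'Q''}^\perp$. **Setting.** Let $S,P$ be disjoint finite sets and let $S$ be the disjoint union of $\tilde Y_1,\tilde Z_1$ (CCVS), $\tilde Y_2,\tilde Z_2$ (VCCS), $\hat Y_1,\hat Z_2$ (CCCS), $\hat Y_2,\hat Z_1$ (VCVS), $R$ (resistors), $E$ (voltage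 sources) and $J$ (current sources), the controlling and controlled edges of each type being in bijection. Let $\mathcal A_{S'S''}$ be the affine space of solutions of $$v_{\tilde Y_1'}=0,\ v_{\tilde Z_1'}=r\,i_{\tilde Y_1''};\quad i_{\tilde Y_2''}=0,\ i_{\tilde Z_2''}=g\,v_{\tilde Y_2'};\quad v_{\hat Y_1'}=0,\ i_{\hat Z_2''}=\alpha\, i_{\hat Y_1''};\quad i_{\hat Y_2''}=0,\ v_{\hat Z_1'}=\beta\, v_{\hat Y_2'};$$ $$v_{R'}=\hat R\, i_{R''};\quad v_{E'}=s_E;\quad i_{J''}=s_J,$$ where $r,g,\alpha,\beta,\hat R$ are diagonal matrices whose diagonal entries, taken all together, are algebraically independent over $\mathbb Q$. Let $\mathcal V_{S'S''}$ be the vector space translate of $\mathcal A_{S'S''}$. Put $Y_j=\tilde Y_j\uplus\hat Y_j$, $Z_j=\tilde Z_j\uplus\hat Z_j$ $(j=1,2)$. Let $\mathcal V^1=\mathcal V^1_{S'P'S''P''}$ be a Dirac space, and let $\mathcal N^g_P=(\mathcal V^1,\mathcal A_{S'S''})$. It is *rigid* if $\mathcal V^1\circ S'S''+\mathcal V_{S'S''}=\mathbb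 R^{S'\uplus S''}$ (full sum) and $(\mathcal V^1\times S'S'')\cap\mathcal V_{S'S''}=0$ (zero intersection). Its port behaviour is $\{f|_{P'\uplus P''}: f\in\mathcal V^1,\ f|_{S'\uplus S''}\in\mathcal A_{S'S''}\}$. **Theorem.** 1. (Necessity) If $\mathcal N^g_P$ is rigid, then the set of columns $Y_1'\uplus E'\uplus Y_2''\uplus J''$ of $\mathcal V^1$ is independent (in particular $Y_1'\uplus E'$ and $Y_2''\uplus J''$ are). 2. (Sufficiency) If $\mathcal V^1$ is over $\mathbb Q$, then $\mathcal N^g_P$ is rigid whenever one of the following holds. (a) $Z_1'\uplus Y_1'\uplus E'$ is included in a column base of $\mathcal V^1\circ S'P'$ and $Z_2'\uplus Y_2'\uplus J'$ is included in a column cobase of $\mathcal V^1\circ S'P'$; the second condition is equivalent to: $Z_2''\uplus Y_2''\uplus J''$ is an independent set of columns of $\mathcal V^1\times S''P''$. (b) $Z_2''\uplus Y_2''\uplus J''$ is included in a column base of $\mathcal V^1\circ S''P''$ and $Z_1''\uplus Y_1''\uplus E''$ is included in a column cobase of $\mathcal V^1\circ S''P''$; the second condition is equivalent to: $Z_1'\uplus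 Y_1'\uplus E'$ is an independent set of columns of $\mathcal V^1\times S'P'$. 3. (Hybrid representation) Let (a) or (b) hold. Then there is a set $T\subseteq S\uplus P$ such that $b_1=T'\uplus(S\uplus P-T)''$ is a column base of $\mathcal V^1$ that contains $Z_1'\uplus Y_1'\uplus E'\uplus Z_2''\uplus Y_2''\uplus J''$. If moreover $\mathcal V^1$ is over $\mathbb Q$, then for every column base $b_1$ of $\mathcal V^1$ of this form that contains these columns, $(b_1\cap P')\uplus(b_1\cap P'')$ is a column base of the vector space translate of the port behaviour, and with $P_1=T\cap P$, $P_2=P-T$ the port behaviour is the solution set of $$\begin{pmatrix} i_{P_1''}\\ v_{P_2'}\end{pmatrix}=\begin{pmatrix} g_{11}&h_{12}\\ h_{21}&r_{22}\end{pmatrix}\begin{pmatrix} v_{P_1'}\\ i_{P_2''}\end{pmatrix}+\begin{pmatrix} s_1\\ s_2\end{pmatrix}$$ for suitable real matrices $g_{11},h_{12},h_{21},r_{22}$ and vectors $s_1,s_2$. -/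

import Mathlib

namespace Multiport

/-! ### Vector spaces on finite sets: restriction, contraction, columns -/

/-- The restriction `V ∘ Y` of a vector space `V` on `X` to the columns named by `j : Y → X`. -/
def restrict {X Y : Type*} (j : Y → X) (V : Submodule ℝ (X → ℝ)) : Submodule ℝ (Y → ℝ) :=
  V.map (LinearMap.funLeft ℝ ℝ j)

/-- The contraction `V × Y` of a vector space `V` on `X` to the columns named by `j : Y → X`:
the restrictions to `Y` of the vectors of `V` that vanish outside `Y`. -/
def contract {X Y : Type*} (j : Y → X) (V : Submodule ℝ (X → ℝ)) : Submodule ℝ (Y → ℝ) where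
  carrier := {g | ∃ f ∈ V, (∀ x, x ∉ Set.range j → f x = 0) ∧ ∀ y, f (j y) = g y}
  zero_mem' := ⟨0, V.zero_mem, fun _ _ => rfl, fun _ => rfl⟩
  add_mem' := by
    rintro _ _ ⟨f, hf, hf0, hfg⟩ ⟨f', hf', hf0', hfg'⟩
    exact ⟨f + f', V.add_mem hf hf', fun x hx => by simp [hf0 x hx, hf0' x hx],
      fun y => by simp [hfg y, hfg' y]⟩
  smul_mem' := by
    rintro c _ ⟨f, hf, hf0, hfg⟩
    exact ⟨c • f, V.smul_mem c hf, fun x hx => by simp [hf0 x hx], fun y => by simp [hfg y]⟩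

/-- The complementary orthogonal space of `V` for the dot product `∑ x, f x * g x`. -/
def perp {X : Type*} [Fintype X] (V : Submodule ℝ (X → ℝ)) : Submodule ℝ (X → ℝ) where
  carrier := {g | ∀ f ∈ V, f ⬝ᵥ g = 0}
  zero_mem' := fun f _ => by simp
  add_mem' := fun {a b} ha hb f hf => by rw [dotProduct_add, ha f hf, hb f hf, add_zero]
  smul_mem' := fun c a ha f hf => by rw [dotProduct_smul, ha f hf, smul_zero]

/-- `M` is a representative matrix of `V`: its rows are independent and generate `V`. -/
def IsRepMatrix {X : Type*} (V : Submodule ℝ (X → ℝ)) {m : ℕ} (M : Matrix (Fin m) X ℝ) : Prop :=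
  LinearIndependent ℝ M.row ∧ Submodule.span ℝ (Set.range M.row) = V

/-- The set `T` of columns of `V` is independent, i.e. the columns `T` of a representative matrix
of `V` are linearly independent; see `colsIndep_iff_forall` for independence of the choice. -/
def ColsIndep {X : Type*} (V : Submodule ℝ (X → ℝ)) (T : Set X) : Prop :=
  ∃ (m : ℕ) (M : Matrix (Fin m) X ℝ), IsRepMatrix V M ∧ LinearIndepOn ℝ M.col T

theorem IsRepMatrix.linearIndepOn {X : Type*} {V : Submodule ℝ (X → ℝ)} {m n : ℕ}
    {M : Matrix (Fin m) X ℝ} {N : Matrix (Fin n) X ℝ} (hM : IsRepMatrix V M)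
    (hN : IsRepMatrix V N) {T : Set X} (h : LinearIndepOn ℝ M.col T) :
    LinearIndepOn ℝ N.col T := by
  have hrow : ∀ a, ∃ c : Fin n → ℝ, ∑ b, c b • N.row b = M.row a := fun a => by
    have : M.row a ∈ Submodule.span ℝ (Set.range N.row) := by
      rw [hN.2, ← hM.2]; exact Submodule.subset_span ⟨a, rfl⟩
    exact (Submodule.mem_span_range_iff_exists_fun ℝ).1 this
  choose C hC using hrow
  have hcol : M.col = (Matrix.mulVecLin (Matrix.of C)) ∘ N.col := by
    funext x a
    have := congrFun (hC a) x
    rw [Finset.sum_apply] at this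
    exact this.symm
  rw [hcol] at h
  exact LinearIndependent.of_comp (Matrix.mulVecLin (Matrix.of C)) h

theorem exists_isRepMatrix {X : Type*} [Finite X] (V : Submodule ℝ (X → ℝ)) :
    ∃ (m : ℕ) (M : Matrix (Fin m) X ℝ), IsRepMatrix V M := by
  let b := Module.finBasis ℝ V
  refine ⟨_, Matrix.of fun a => (b a : X → ℝ), ?_, ?_⟩
  · exact b.linearIndependent.map' V.subtype V.ker_subtype
  · have h := congrArg (Submodule.map V.subtype) b.span_eq
    rw [Submodule.map_span, ← Set.range_comp, Submodule.map_subtype_top] at h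
    exact h

theorem colsIndep_iff_forall {X : Type*} [Finite X] (V : Submodule ℝ (X → ℝ)) (T : Set X) :
    ColsIndep V T ↔ ∀ (m : ℕ) (M : Matrix (Fin m) X ℝ), IsRepMatrix V M →
      LinearIndepOn ℝ M.col T := by
  constructor
  · rintro ⟨m, M, hM, h⟩ n N hN
    exact hM.linearIndepOn hN h
  · intro h
    obtain ⟨m, M, hM⟩ := exists_isRepMatrix V
    exact ⟨m, M, hM, h m M hM⟩

/-- A column base of `V` is a maximal independent set of columns of `V`. -/
def IsColBase {X : Type*} (V : Submodule ℝ (X → ℝ)) (T : Set X) : Prop :=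
  Maximal (ColsIndep V) T

/-- A column cobase of `V` is the complement of a column base of `V`. -/
def IsColCobase {X : Type*} (V : Submodule ℝ (X → ℝ)) (T : Set X) : Prop :=
  IsColBase V Tᶜ

/-- `V` is a vector space over `ℚ`: it has a representative matrix with rational entries. -/
def IsOverRat {X : Type*} (V : Submodule ℝ (X → ℝ)) : Prop :=
  ∃ (m : ℕ) (M : Matrix (Fin m) X ℚ), IsRepMatrix V (M.map (fun q : ℚ => (q : ℝ)))

/-! ### Voltage and current variables, Dirac spaces -/

/-- The set `Q' ⊎ Q''` of voltage and current variables of the edge set `Q`. -/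
abbrev Var (Q : Type*) := Q ⊕ Q

/-- The voltage variable `q'` of the edge `q`. -/
abbrev volt {Q : Type*} (q : Q) : Var Q := Sum.inl q

/-- The current variable `q''` of the edge `q`. -/
abbrev curr {Q : Type*} (q : Q) : Var Q := Sum.inr q

/-- `V` on `Q' ⊎ Q''` is Dirac: interchanging `Q'` and `Q''` in `V` yields `V^⊥`. -/
def IsDirac {Q : Type*} [Fintype Q] (V : Submodule ℝ (Var Q → ℝ)) : Prop :=
  V.map (LinearMap.funLeft ℝ ℝ (Sum.swap : Var Q → Var Q)) = perp V

/-! ### Generalized multiports -/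

/-- The inclusion of the device variables `S' ⊎ S''` into `S' ⊎ P' ⊎ S'' ⊎ P''`. -/
def devVar {S P : Type*} : Var S → Var (S ⊕ P) := Sum.map Sum.inl Sum.inl

/-- The inclusion of the port variables `P' ⊎ P''` into `S' ⊎ P' ⊎ S'' ⊎ P''`. -/
def portVar {S P : Type*} : Var P → Var (S ⊕ P) := Sum.map Sum.inr Sum.inr

/-- A linear generalized multiport: a vector space on `S' ⊎ P' ⊎ S'' ⊎ P''` together with an
affine device characteristic on `S' ⊎ S''`. -/
structure GenMultiport (S P : Type*) where
  /-- the space of solutions of the (generalized) topological constraints -/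
  topo : Submodule ℝ (Var (S ⊕ P) → ℝ)
  /-- the device characteristic -/
  device : AffineSubspace ℝ (Var S → ℝ)

namespace GenMultiport

variable {S P : Type*}

/-- The full sum property: `V¹ ∘ S'S'' + V_{S'S''} = F_{S'S''}`, where `V_{S'S''}` is the vector
space translate of the device characteristic. -/
def FullSum (N : GenMultiport S P) : Prop :=
  restrict devVar N.topo ⊔ N.device.direction = ⊤

/-- The zero intersection property: `(V¹ × S'S'') ∩ V_{S'S''} = 0_{S'S''}`. -/
def ZeroIntersection (N : GenMultiport S P) : Prop :=
  contract devVar N.topo ⊓ N.device.direction = ⊥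

/-- Rigidity: both the full sum and the zero intersection property hold. -/
def IsRigid (N : GenMultiport S P) : Prop :=
  N.FullSum ∧ N.ZeroIntersection

/-- The port behaviour, i.e. the matched composition of the two spaces: the restrictions to
`P' ⊎ P''` of those vectors of `V¹` whose restriction to `S' ⊎ S''` is in the device
characteristic. -/
def portBehaviour (N : GenMultiport S P) : AffineSubspace ℝ (Var P → ℝ) :=
  (N.topo.toAffineSubspace ⊓
    N.device.comap (LinearMap.funLeft ℝ ℝ (devVar : Var S → Var (S ⊕ P))).toAffineMap).map
      (LinearMap.funLeft ℝ ℝ (portVar : Var P → Var (S ⊕ P))).toAffineMap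

end GenMultiport

open Classical in
/-- `A` on `P' ⊎ P''` has a hybrid representation with respect to `P₁ ⊆ P` and `P₂ = P - P₁`: it is
the solution set of `i_{P₁} = g₁₁ v_{P₁} + h₁₂ i_{P₂} + s₁`, `v_{P₂} = h₂₁ v_{P₁} + r₂₂ i_{P₂} + s₂`
for some matrices and vectors. -/
def HasHybridRep {P : Type*} [Fintype P] (A : AffineSubspace ℝ (Var P → ℝ)) (P₁ : Set P) : Prop :=
  ∃ (g₁₁ : Matrix {p // p ∈ P₁} {p // p ∈ P₁} ℝ) (h₁₂ : Matrix {p // p ∈ P₁} {p // p ∉ P₁} ℝ)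
    (h₂₁ : Matrix {p // p ∉ P₁} {p // p ∈ P₁} ℝ) (r₂₂ : Matrix {p // p ∉ P₁} {p // p ∉ P₁} ℝ)
    (s₁ : {p // p ∈ P₁} → ℝ) (s₂ : {p // p ∉ P₁} → ℝ),
    ∀ f : Var P → ℝ, f ∈ A ↔
      (fun p : {p // p ∈ P₁} => f (curr p.1)) =
          g₁₁.mulVec (fun q => f (volt q.1)) + h₁₂.mulVec (fun q => f (curr q.1)) + s₁ ∧
      (fun p : {p // p ∉ P₁} => f (volt p.1)) =
          h₂₁.mulVec (fun q => f (volt q.1)) + r₂₂.mulVec (fun q => f (curr q.1)) + s₂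

/-! ### Sources, controlled sources and resistors -/

/-- The edges of a device characteristic that is composed of `κ₁` many CCVS, `κ₂` many VCCS,
`κ₃` many CCCS, `κ₄` many VCVS, `ρ` many resistors, `ε` many voltage sources and `ι` many current
sources.  A controlled source has a controlling edge (`Y`) and a controlled edge (`Z`). -/
inductive DevEdge (κ₁ κ₂ κ₃ κ₄ ρ ε ι : Type*)
  | ccvsY (k : κ₁)
  | ccvsZ (k : κ₁)
  | vccsY (k : κ₂)
  | vccsZ (k : κ₂)
  | cccsY (k : κ₃)
  | cccsZ (k : κ₃)
  | vcvsY (k : κ₄)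
  | vcvsZ (k : κ₄)
  | res (k : ρ)
  | vsrc (k : ε)
  | isrc (k : ι)

namespace DevEdge

variable {κ₁ κ₂ κ₃ κ₄ ρ ε ι : Type*}

/-- The edges as the elements of a disjoint union, for finiteness. -/
def equivSum : DevEdge κ₁ κ₂ κ₃ κ₄ ρ ε ι ≃
    (κ₁ ⊕ κ₁) ⊕ (κ₂ ⊕ κ₂) ⊕ (κ₃ ⊕ κ₃) ⊕ (κ₄ ⊕ κ₄) ⊕ ρ ⊕ ε ⊕ ι where
  toFun
    | ccvsY k => .inl (.inl k)
    | ccvsZ k => .inl (.inr k)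
    | vccsY k => .inr (.inl (.inl k))
    | vccsZ k => .inr (.inl (.inr k))
    | cccsY k => .inr (.inr (.inl (.inl k)))
    | cccsZ k => .inr (.inr (.inl (.inr k)))
    | vcvsY k => .inr (.inr (.inr (.inl (.inl k))))
    | vcvsZ k => .inr (.inr (.inr (.inl (.inr k))))
    | res k => .inr (.inr (.inr (.inr (.inl k))))
    | vsrc k => .inr (.inr (.inr (.inr (.inr (.inl k)))))
    | isrc k => .inr (.inr (.inr (.inr (.inr (.inr k)))))
  invFun
    | .inl (.inl k) => ccvsY k
    | .inl (.inr k) => ccvsZ k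
    | .inr (.inl (.inl k)) => vccsY k
    | .inr (.inl (.inr k)) => vccsZ k
    | .inr (.inr (.inl (.inl k))) => cccsY k
    | .inr (.inr (.inl (.inr k))) => cccsZ k
    | .inr (.inr (.inr (.inl (.inl k)))) => vcvsY k
    | .inr (.inr (.inr (.inl (.inr k)))) => vcvsZ k
    | .inr (.inr (.inr (.inr (.inl k)))) => res k
    | .inr (.inr (.inr (.inr (.inr (.inl k))))) => vsrc k
    | .inr (.inr (.inr (.inr (.inr (.inr k))))) => isrc k
  left_inv := by rintro (_ | _ | _ | _ | _ | _ | _ | _ | _ | _ | _) <;> rfl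
  right_inv := by
    rintro ((_ | _) | (_ | _) | (_ | _) | (_ | _) | _ | _ | _) <;> rfl

instance [Fintype κ₁] [Fintype κ₂] [Fintype κ₃] [Fintype κ₄] [Fintype ρ] [Fintype ε]
    [Fintype ι] : Fintype (DevEdge κ₁ κ₂ κ₃ κ₄ ρ ε ι) :=
  Fintype.ofEquiv _ equivSum.symm

/-- `Y₁`: the controlling current branches. -/
def Y₁ : Set (DevEdge κ₁ κ₂ κ₃ κ₄ ρ ε ι) := Set.range ccvsY ∪ Set.range cccsY

/-- `Y₂`: the controlling voltage branches. -/
def Y₂ : Set (DevEdge κ₁ κ₂ κ₃ κ₄ ρ ε ι) := Set.range vccsY ∪ Set.range vcvsY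

/-- `Z₁`: the controlled voltage source branches. -/
def Z₁ : Set (DevEdge κ₁ κ₂ κ₃ κ₄ ρ ε ι) := Set.range ccvsZ ∪ Set.range vcvsZ

/-- `Z₂`: the controlled current source branches. -/
def Z₂ : Set (DevEdge κ₁ κ₂ κ₃ κ₄ ρ ε ι) := Set.range vccsZ ∪ Set.range cccsZ

/-- `E`: the voltage source branches. -/
def E : Set (DevEdge κ₁ κ₂ κ₃ κ₄ ρ ε ι) := Set.range vsrc

/-- `J`: the current source branches. -/
def J : Set (DevEdge κ₁ κ₂ κ₃ κ₄ ρ ε ι) := Set.range isrc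

end DevEdge

/-- The values of the device parameters and of the independent sources. -/
structure DevData (κ₁ κ₂ κ₃ κ₄ ρ ε ι : Type*) where
  /-- transresistances of the CCVS -/
  r : κ₁ → ℝ
  /-- transconductances of the VCCS -/
  g : κ₂ → ℝ
  /-- current gains of the CCCS -/
  α : κ₃ → ℝ
  /-- voltage gains of the VCVS -/
  β : κ₄ → ℝ
  /-- resistances -/
  R : ρ → ℝ
  /-- voltages of the voltage sources -/
  sE : ε → ℝ
  /-- currents of the current sources -/
  sJ : ι → ℝ

namespace DevData

variable {κ₁ κ₂ κ₃ κ₄ ρ ε ι : Type*}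

/-- The family of all controlled source parameters and resistances. -/
def param (D : DevData κ₁ κ₂ κ₃ κ₄ ρ ε ι) : κ₁ ⊕ κ₂ ⊕ κ₃ ⊕ κ₄ ⊕ ρ → ℝ :=
  Sum.elim D.r (Sum.elim D.g (Sum.elim D.α (Sum.elim D.β D.R)))

open DevEdge in
/-- The device characteristic: the affine space of all voltage-current vectors that satisfy the
equations of all the devices. -/
def characteristic (D : DevData κ₁ κ₂ κ₃ κ₄ ρ ε ι) :
    AffineSubspace ℝ (Var (DevEdge κ₁ κ₂ κ₃ κ₄ ρ ε ι) → ℝ) where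
  carrier := {x |
    (∀ k, x (volt (ccvsY k)) = 0 ∧ x (volt (ccvsZ k)) = D.r k * x (curr (ccvsY k))) ∧
    (∀ k, x (curr (vccsY k)) = 0 ∧ x (curr (vccsZ k)) = D.g k * x (volt (vccsY k))) ∧
    (∀ k, x (volt (cccsY k)) = 0 ∧ x (curr (cccsZ k)) = D.α k * x (curr (cccsY k))) ∧
    (∀ k, x (curr (vcvsY k)) = 0 ∧ x (volt (vcvsZ k)) = D.β k * x (volt (vcvsY k))) ∧
    (∀ k, x (volt (res k)) = D.R k * x (curr (res k))) ∧
    (∀ k, x (volt (vsrc k)) = D.sE k) ∧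
    (∀ k, x (curr (isrc k)) = D.sJ k)}
  smul_vsub_vadd_mem' := by
    rintro c x y z ⟨x1, x2, x3, x4, x5, x6, x7⟩ ⟨y1, y2, y3, y4, y5, y6, y7⟩
      ⟨z1, z2, z3, z4, z5, z6, z7⟩
    refine ⟨fun k => ⟨?_, ?_⟩, fun k => ⟨?_, ?_⟩, fun k => ⟨?_, ?_⟩, fun k => ⟨?_, ?_⟩,
      fun k => ?_, fun k => ?_, fun k => ?_⟩ <;>
      simp only [vsub_eq_sub, vadd_eq_add, Pi.add_apply, Pi.smul_apply, Pi.sub_apply, smul_eq_mul]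
    · rw [(x1 k).1, (y1 k).1, (z1 k).1]; ring
    · rw [(x1 k).2, (y1 k).2, (z1 k).2]; ring
    · rw [(x2 k).1, (y2 k).1, (z2 k).1]; ring
    · rw [(x2 k).2, (y2 k).2, (z2 k).2]; ring
    · rw [(x3 k).1, (y3 k).1, (z3 k).1]; ring
    · rw [(x3 k).2, (y3 k).2, (z3 k).2]; ring
    · rw [(x4 k).1, (y4 k).1, (z4 k).1]; ring
    · rw [(x4 k).2, (y4 k).2, (z4 k).2]; ring
    · rw [x5 k, y5 k, z5 k]; ring
    · rw [x6 k, y6 k, z6 k]; ring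
    · rw [x7 k, y7 k, z7 k]; ring

end DevData

/-- Condition (a): `Z₁' ∪ Y₁' ∪ E'` is included in a column base of `V ∘ S'P'` and
`Z₂' ∪ Y₂' ∪ J'` is included in a column cobase of `V ∘ S'P'`. -/
def CondA {κ₁ κ₂ κ₃ κ₄ ρ ε ι P : Type*}
    (V : Submodule ℝ (Var (DevEdge κ₁ κ₂ κ₃ κ₄ ρ ε ι ⊕ P) → ℝ)) : Prop :=
  (∃ b, IsColBase (restrict volt V) b ∧ Sum.inl '' (DevEdge.Z₁ ∪ DevEdge.Y₁ ∪ DevEdge.E) ⊆ b) ∧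
  ∃ c, IsColCobase (restrict volt V) c ∧ Sum.inl '' (DevEdge.Z₂ ∪ DevEdge.Y₂ ∪ DevEdge.J) ⊆ c

/-- Condition (b): `Z₂'' ∪ Y₂'' ∪ J''` is included in a column base of `V ∘ S''P''` and
`Z₁'' ∪ Y₁'' ∪ E''` is included in a column cobase of `V ∘ S''P''`. -/
def CondB {κ₁ κ₂ κ₃ κ₄ ρ ε ι P : Type*}
    (V : Submodule ℝ (Var (DevEdge κ₁ κ₂ κ₃ κ₄ ρ ε ι ⊕ P) → ℝ)) : Prop :=
  (∃ b, IsColBase (restrict curr V) b ∧ Sum.inl '' (DevEdge.Z₂ ∪ DevEdge.Y₂ ∪ DevEdge.J) ⊆ b) ∧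
  ∃ c, IsColCobase (restrict curr V) c ∧ Sum.inl '' (DevEdge.Z₁ ∪ DevEdge.Y₁ ∪ DevEdge.E) ⊆ c

/-- The set of columns `T' ∪ (S ⊎ P - T)''`, for a set `T` of edges. -/
def complCols {Q : Type*} (T : Set Q) : Set (Var Q) := volt '' T ∪ curr '' Tᶜ

end Multiport

open Multiport

namespace Multiport

/-! ### Orthogonal complements, independent columns and column bases -/

section Columns

variable {X : Type*}

/-! Necessity: differences of device solutions vanish on the columns `Y₁'`, `E'`, `Y₂''`, `J''`.
Under the full sum property the vectors of `V` must therefore produce arbitrary values there, which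
is independence (`colsIndep_of_fullSum`).

For sufficiency and the hybrid representation, let `complCols T` be a column base of `V` containing
the prescribed variables. It selects one variable of each edge, so `V` has dimension `|S ⊎ P|`, and
the device equations together with prescribed values of the selected port variables form a square
system on `V`. Unique solvability of this system gives both rigidity and a parametrization of the
port behaviour by the selected port variables (`isRigid_of_netEquiv`, `portBehaviour_of_netEquiv`).

When `V` is over `ℚ`, a trivial kernel means that a polynomial with rational coefficients does not
vanish at the parameters. For algebraically independent parameters it thus suffices to find one good
choice of values (`IsOverRat.sysMap_ker`). Zero gains and unit resistances will do: by Tellegen's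
theorem the dissipated power `∑ v²` over the resistors is zero, so a solution vanishes on the whole
column base (`netMap_special_ker`).

Under (a) or (b) such a base comes from matroid extension in `V ∘ S'P'` or `V ∘ S''P''`. For a Dirac
space the contraction to the other kind of variable is the orthogonal complement, so the
complementary columns complete the base. -/

theorem exists_mem_perp_of_notMem [Fintype X] {V : Submodule ℝ (X → ℝ)} {x : X → ℝ} (hx : x ∉ V) :
    ∃ g ∈ perp V, x ⬝ᵥ g ≠ 0 := by
  classical
  obtain ⟨φ, hφ, hV⟩ := Submodule.exists_le_ker_of_notMem hx
  have key : ∀ y : X → ℝ, φ y = y ⬝ᵥ fun i => φ (Pi.single i 1) := fun y => by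
    rw [LinearMap.pi_apply_eq_sum_univ φ y]
    simp only [dotProduct, smul_eq_mul]
    refine Finset.sum_congr rfl fun i _ => ?_
    congr 2
    funext j
    simp [Pi.single_apply, eq_comm]
  exact ⟨_, fun f hf => (key f).symm.trans (hV hf), fun h => hφ ((key x).trans h)⟩

theorem perp_perp [Fintype X] (V : Submodule ℝ (X → ℝ)) : perp (perp V) = V := by
  ext x
  refine ⟨fun h => ?_, fun h g hg => by rw [dotProduct_comm]; exact hg x h⟩
  by_contra hx
  obtain ⟨g, hg, hne⟩ := exists_mem_perp_of_notMem hx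
  exact hne (by rw [dotProduct_comm]; exact h g hg)

theorem IsRepMatrix.mem_perp [Fintype X] {V : Submodule ℝ (X → ℝ)} {m : ℕ}
    {M : Matrix (Fin m) X ℝ} (hM : IsRepMatrix V M) {g : X → ℝ} :
    g ∈ perp V ↔ ∀ a, M.row a ⬝ᵥ g = 0 := by
  refine ⟨fun h a => h _ (hM.2 ▸ Submodule.subset_span ⟨a, rfl⟩), fun h f hf => ?_⟩
  rw [← hM.2] at hf
  induction hf using Submodule.span_induction with
  | mem x hx => obtain ⟨a, rfl⟩ := hx; exact h a
  | zero => simp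
  | add x y _ _ hx hy => rw [add_dotProduct, hx, hy, add_zero]
  | smul c x _ hx => rw [smul_dotProduct, hx, smul_zero]

/-- A set of columns of `V` is independent iff it supports no nonzero vector of `V^⊥`. -/
theorem colsIndep_iff_perp [Fintype X] {V : Submodule ℝ (X → ℝ)} {T : Set X} :
    ColsIndep V T ↔ ∀ g ∈ perp V, (∀ x ∉ T, g x = 0) → g = 0 := by
  classical
  obtain ⟨m, M, hM⟩ := exists_isRepMatrix V
  have h1 : ColsIndep V T ↔ LinearIndepOn ℝ M.col T :=
    ⟨fun h => (colsIndep_iff_forall V T).1 h m M hM, fun h => ⟨m, M, hM, h⟩⟩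
  -- The vectors of `V^⊥` are exactly the coefficient vectors of the linear relations between the
  -- columns of `M`.
  have h2 : ∀ g : X → ℝ, g ∈ perp V ↔ ∑ x, g x • M.col x = 0 := fun g => by
    rw [hM.mem_perp, funext_iff]
    refine forall_congr' fun a => ?_
    simp [dotProduct, Matrix.row, Matrix.col, mul_comm]
  rw [h1, LinearIndepOn, Fintype.linearIndependent_iff]
  constructor
  · intro h g hg h0
    have hs : ∑ x : T, g x • M.col (x : X) = 0 := by
      rw [← (h2 g).1 hg, ← Fintype.sum_subtype_add_sum_subtype (· ∈ T) fun x => g x • M.col x]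
      rw [left_eq_add]
      exact Finset.sum_eq_zero fun x _ => by rw [h0 x x.2, zero_smul]
    funext x
    by_cases hx : x ∈ T
    · exact h (fun x => g x) hs ⟨x, hx⟩
    · exact h0 x hx
  · intro h c hc i
    let g : X → ℝ := fun x => if hx : x ∈ T then c ⟨x, hx⟩ else 0
    have hg : g = 0 := by
      refine h g ((h2 g).2 ?_) fun x hx => dif_neg hx
      rw [← Fintype.sum_subtype_add_sum_subtype (· ∈ T) fun x => g x • M.col x,
        Finset.sum_eq_zero (s := Finset.univ) (f := fun x : {x // x ∉ T} => g x • M.col (x : X))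
          fun x _ => by simp [g, x.2], add_zero, ← hc]
      exact Finset.sum_congr rfl fun x _ => by simp [g]
    simpa [g] using congrFun hg i

theorem ColsIndep.mono [Fintype X] {V : Submodule ℝ (X → ℝ)} {T U : Set X} (h : ColsIndep V U)
    (hTU : T ⊆ U) : ColsIndep V T :=
  colsIndep_iff_perp.2 fun g hg h0 =>
    colsIndep_iff_perp.1 h g hg fun x hx => h0 x fun hx' => hx (hTU hx')

/-- The vectors of `V` take arbitrary values on an independent set of columns. -/
theorem ColsIndep.exists_eqOn [Fintype X] {V : Submodule ℝ (X → ℝ)} {T : Set X}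
    (h : ColsIndep V T) (y : X → ℝ) : ∃ f ∈ V, ∀ x ∈ T, f x = y x := by
  classical
  let W : Submodule ℝ (X → ℝ) :=
    { carrier := {f | ∀ x ∈ T, f x = 0}
      zero_mem' := fun _ _ => rfl
      add_mem' := fun {a b} ha hb x hx => by simp [ha x hx, hb x hx]
      smul_mem' := fun c a ha x hx => by simp [ha x hx] }
  -- A vector orthogonal to `V` and `W` lies in `V^⊥` and, tested on unit vectors, is supported on
  -- `T`; hence it is zero.
  have htop : y ∈ V ⊔ W := by
    by_contra hy
    obtain ⟨g, hg, hne⟩ := exists_mem_perp_of_notMem hy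
    refine hne ?_
    rw [colsIndep_iff_perp.1 h g (fun f hf => hg f (Submodule.mem_sup_left hf)) fun x hx => ?_,
      dotProduct_zero]
    have hW : (Pi.single x 1 : X → ℝ) ∈ W := fun z hz =>
      Pi.single_eq_of_ne (by rintro rfl; exact hx hz) 1
    simpa using hg _ (Submodule.mem_sup_right hW)
  obtain ⟨f, hf, w, hw, rfl⟩ := Submodule.mem_sup.1 htop
  exact ⟨f, hf, fun x hx => by simp [hw x hx]⟩

/-- If a vector of `V` vanishes on the independent set `T` but not at `x`, then `T ∪ {x}` is
independent. -/
theorem ColsIndep.insert [Fintype X] {V : Submodule ℝ (X → ℝ)} {T : Set X} (h : ColsIndep V T)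
    {f : X → ℝ} (hf : f ∈ V) (h0 : ∀ x ∈ T, f x = 0) {x : X} (hx : f x ≠ 0) :
    ColsIndep V (insert x T) := by
  refine colsIndep_iff_perp.2 fun g hg hgT => colsIndep_iff_perp.1 h g hg fun z hz => ?_
  by_cases hzx : z = x
  · subst hzx
    -- `f` vanishes on `T` and `g` off `T ∪ {z}`, so one term of the dot product survives.
    have hd : f ⬝ᵥ g = f z * g z := Finset.sum_eq_single_of_mem z (Finset.mem_univ z)
      fun w _ hw => by
        by_cases hwT : w ∈ T
        · rw [h0 w hwT, zero_mul]
        · rw [hgT w (by simp [hw, hwT]), mul_zero]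
    exact (mul_eq_zero.1 (hd.symm.trans (hg f hf))).resolve_left hx
  · exact hgT z (by simp [hzx, hz])

theorem isColBase_iff [Fintype X] {V : Submodule ℝ (X → ℝ)} {b : Set X} :
    IsColBase V b ↔ ColsIndep V b ∧ ∀ f ∈ V, (∀ x ∈ b, f x = 0) → f = 0 := by
  classical
  constructor
  · refine fun h => ⟨h.1, fun f hf h0 => funext fun x => ?_⟩
    by_contra hx
    exact hx (h0 x (h.2 (h.1.insert hf h0 hx) (Set.subset_insert x b) (Set.mem_insert x b)))
  · rintro ⟨hi, hs⟩
    refine ⟨hi, fun c hc hbc x hx => ?_⟩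
    by_contra hxb
    obtain ⟨f, hf, hfc⟩ := hc.exists_eqOn (Pi.single x 1)
    have := hs f hf fun z hz => by
      rw [hfc z (hbc hz)]
      exact Pi.single_eq_of_ne (by rintro rfl; exact hxb hz) 1
    have h1 := hfc x hx
    simp [this] at h1

/-- An independent set of columns inside a spanning set of columns extends to a column base inside
that spanning set. -/
theorem ColsIndep.exists_isColBase [Fintype X] {V : Submodule ℝ (X → ℝ)} {A C : Set X}
    (hA : ColsIndep V A) (hAC : A ⊆ C) (hC : ∀ f ∈ V, (∀ x ∈ C, f x = 0) → f = 0) :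
    ∃ b, IsColBase V b ∧ A ⊆ b ∧ b ⊆ C := by
  obtain ⟨b, hAb, hb⟩ := Finite.exists_le_maximal (p := fun b => ColsIndep V b ∧ b ⊆ C) ⟨hA, hAC⟩
  refine ⟨b, isColBase_iff.2 ⟨hb.1.1, fun f hf h0 => hC f hf fun x hx => ?_⟩, hAb, hb.1.2⟩
  by_contra hfx
  exact hfx (h0 x (hb.2 ⟨hb.1.1.insert hf h0 hfx, Set.insert_subset hx hb.1.2⟩
    (Set.subset_insert x b) (Set.mem_insert x b)))

theorem colsIndep_empty [Fintype X] (V : Submodule ℝ (X → ℝ)) : ColsIndep V ∅ :=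
  colsIndep_iff_perp.2 fun _ _ h => funext fun x => h x (Set.notMem_empty x)

/-- Lying in a cobase means that the complement of `B` contains a base, that is, that this
complement spans. -/
theorem exists_isColCobase_iff [Fintype X] {V : Submodule ℝ (X → ℝ)} {B : Set X} :
    (∃ c, IsColCobase V c ∧ B ⊆ c) ↔ ∀ f ∈ V, (∀ x ∉ B, f x = 0) → f = 0 := by
  constructor
  · rintro ⟨c, hc, hBc⟩ f hf h0
    exact (isColBase_iff.1 hc).2 f hf fun x hx => h0 x fun hxB => hx (hBc hxB)
  · intro h
    obtain ⟨b, hb, -, hbC⟩ :=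
      (colsIndep_empty V).exists_isColBase (Set.empty_subset Bᶜ) fun f hf h0 => h f hf h0
    exact ⟨bᶜ, by rwa [IsColCobase, compl_compl], Set.subset_compl_comm.1 hbC⟩

end Columns

/-! ### Complementary sets of columns -/

section ComplCols

variable {Q : Type*}

theorem mem_complCols_volt {T : Set Q} {q : Q} : volt q ∈ complCols T ↔ q ∈ T := by
  simp [complCols]

theorem mem_complCols_curr {T : Set Q} {q : Q} : curr q ∈ complCols T ↔ q ∉ T := by
  simp [complCols]

open Classical in
/-- The variable of the edge `q` that belongs to `complCols T`. -/
noncomputable def selVar (T : Set Q) (q : Q) : Var Q := if q ∈ T then volt q else curr q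

theorem selVar_mem (T : Set Q) (q : Q) : selVar T q ∈ complCols T := by
  unfold selVar complCols
  split_ifs with h
  · exact Or.inl ⟨q, h, rfl⟩
  · exact Or.inr ⟨q, h, rfl⟩

end ComplCols

/-! ### Dirac spaces -/

section Dirac

variable {Q : Type*} [Fintype Q] {V : Submodule ℝ (Var Q → ℝ)}

theorem IsDirac.mem_perp_iff (hV : IsDirac V) {g : Var Q → ℝ} :
    g ∈ perp V ↔ g ∘ Sum.swap ∈ V := by
  rw [← hV]
  constructor
  · rintro ⟨f, hf, rfl⟩
    have : (LinearMap.funLeft ℝ ℝ (Sum.swap : Var Q → Var Q)) f ∘ Sum.swap = f := by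
      funext x; simp [LinearMap.funLeft_apply]
    rwa [this]
  · exact fun h => ⟨_, h, by funext x; simp [LinearMap.funLeft_apply]⟩

/-- Membership of `g` in the contraction says `(0, g) ∈ V`; swapping turns this into `(g, 0) ∈ V^⊥`,
which tests `g` against voltages only. -/
theorem IsDirac.contract_curr (hV : IsDirac V) : contract curr V = perp (restrict volt V) := by
  ext g
  have h1 : g ∈ perp (restrict volt V) ↔ (Sum.elim g 0 : Var Q → ℝ) ∈ perp V := by
    constructor
    · intro h f hf
      simpa [dotProduct] using h _ ⟨f, hf, rfl⟩
    · rintro h _ ⟨f, hf, rfl⟩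
      simpa [dotProduct, LinearMap.funLeft_apply] using h f hf
  have h2 : (Sum.elim g 0 : Var Q → ℝ) ∘ Sum.swap = Sum.elim (0 : Q → ℝ) g := by
    funext x; rcases x with x | x <;> rfl
  rw [h1, hV.mem_perp_iff, h2]
  constructor
  · rintro ⟨f, hf, h0, hg⟩
    convert hf using 1
    funext x
    rcases x with x | x
    · exact (h0 _ (by simp)).symm
    · exact (hg x).symm
  · refine fun h => ⟨_, h, fun x hx => ?_, fun y => rfl⟩
    rcases x with x | x
    · rfl
    · exact absurd ⟨x, rfl⟩ hx

theorem IsDirac.contract_volt (hV : IsDirac V) : contract volt V = perp (restrict curr V) := by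
  ext g
  have h1 : g ∈ perp (restrict curr V) ↔ (Sum.elim 0 g : Var Q → ℝ) ∈ perp V := by
    constructor
    · intro h f hf
      simpa [dotProduct] using h _ ⟨f, hf, rfl⟩
    · rintro h _ ⟨f, hf, rfl⟩
      simpa [dotProduct, LinearMap.funLeft_apply] using h f hf
  have h2 : (Sum.elim 0 g : Var Q → ℝ) ∘ Sum.swap = Sum.elim g (0 : Q → ℝ) := by
    funext x; rcases x with x | x <;> rfl
  rw [h1, hV.mem_perp_iff, h2]
  constructor
  · rintro ⟨f, hf, h0, hg⟩
    convert hf using 1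
    funext x
    rcases x with x | x
    · exact (hg x).symm
    · exact (h0 _ (by simp)).symm
  · refine fun h => ⟨_, h, fun x hx => ?_, fun y => rfl⟩
    rcases x with x | x
    · exact absurd ⟨x, rfl⟩ hx
    · rfl

/-- Both sides say that no nonzero vector of `V ∘ Q'` is supported on `B`. -/
theorem IsDirac.cobase_volt_iff (hV : IsDirac V) {B : Set Q} :
    (∃ c, IsColCobase (restrict volt V) c ∧ B ⊆ c) ↔ ColsIndep (contract curr V) B := by
  rw [exists_isColCobase_iff, colsIndep_iff_perp, hV.contract_curr, perp_perp]

theorem IsDirac.cobase_curr_iff (hV : IsDirac V) {B : Set Q} :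
    (∃ c, IsColCobase (restrict curr V) c ∧ B ⊆ c) ↔ ColsIndep (contract volt V) B := by
  rw [exists_isColCobase_iff, colsIndep_iff_perp, hV.contract_volt, perp_perp]

/-- Tellegen's theorem for a Dirac space. -/
theorem IsDirac.sum_power (hV : IsDirac V) {f : Var Q → ℝ} (hf : f ∈ V) :
    ∑ q, f (volt q) * f (curr q) = 0 := by
  -- The dot product of `f` with its own swap is twice the total power.
  have hsw : f ∘ Sum.swap ∈ perp V := by
    rw [hV.mem_perp_iff]
    convert hf using 1
    funext x; simp
  have := hsw f hf
  simp only [dotProduct, Fintype.sum_sum_type, Function.comp_apply, Sum.swap_inl,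
    Sum.swap_inr] at this
  simp only [mul_comm (f (curr _))] at this
  linarith

/-- Swapping maps `complCols T` onto its complement. Hence a vector of `V^⊥` supported on `complCols
T` swaps to a vector of `V` vanishing there, and spanning already implies independence. -/
theorem IsDirac.isColBase_complCols_iff (hV : IsDirac V) {T : Set Q} :
    IsColBase V (complCols T) ↔ ∀ f ∈ V, (∀ x ∈ complCols T, f x = 0) → f = 0 := by
  rw [isColBase_iff]
  refine ⟨And.right, fun h => ⟨colsIndep_iff_perp.2 fun g hg h0 => ?_, h⟩⟩
  have := h _ (hV.mem_perp_iff.1 hg) fun x hx => h0 _ fun hx' => by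
    rcases x with q | q
    · exact mem_complCols_curr.1 hx' (mem_complCols_volt.1 hx)
    · exact mem_complCols_curr.1 hx (mem_complCols_volt.1 hx')
  funext x
  simpa using congrFun this x.swap

/-- A column base of `V ∘ Q'` yields a column base of the Dirac space `V`. -/
theorem IsDirac.isColBase_of_volt (hV : IsDirac V) {T : Set Q}
    (hT : IsColBase (restrict volt V) T) : IsColBase V (complCols T) := by
  rw [isColBase_iff, colsIndep_iff_perp, ← hV.contract_curr] at hT
  refine hV.isColBase_complCols_iff.2 fun f hf h0 => ?_
  have h1 : f ∘ volt = 0 :=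
    hT.2 _ ⟨f, hf, rfl⟩ fun q hq => h0 _ (mem_complCols_volt.2 hq)
  -- With zero voltages the currents lie in `(V ∘ Q')^⊥`; they are supported on `T`, which is
  -- independent.
  have h2 : f ∘ curr = 0 := by
    refine hT.1 _ ⟨f, hf, fun x hx => ?_, fun _ => rfl⟩ fun q hq => h0 _ (mem_complCols_curr.2 hq)
    rcases x with q | q
    · exact congrFun h1 q
    · exact absurd ⟨q, rfl⟩ hx
  funext x
  rcases x with q | q
  · exact congrFun h1 q
  · exact congrFun h2 q

/-- A column base of `V ∘ Q''` yields a column base of the Dirac space `V`. -/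
theorem IsDirac.isColBase_of_curr (hV : IsDirac V) {T : Set Q}
    (hT : IsColBase (restrict curr V) Tᶜ) : IsColBase V (complCols T) := by
  rw [isColBase_iff, colsIndep_iff_perp, ← hV.contract_volt] at hT
  refine hV.isColBase_complCols_iff.2 fun f hf h0 => ?_
  have h1 : f ∘ curr = 0 :=
    hT.2 _ ⟨f, hf, rfl⟩ fun q hq => h0 _ (mem_complCols_curr.2 hq)
  have h2 : f ∘ volt = 0 := by
    refine hT.1 _ ⟨f, hf, fun x hx => ?_, fun _ => rfl⟩ fun q hq =>
      h0 _ (mem_complCols_volt.2 (not_not.1 hq))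
    rcases x with q | q
    · exact absurd ⟨q, rfl⟩ hx
    · exact congrFun h1 q
  funext x
  rcases x with q | q
  · exact congrFun h2 q
  · exact congrFun h1 q

end Dirac

/-- If `g ∈ V^⊥` is supported on `T`, a vector of `V` that agrees with `g` on `T` gives `g ⬝ᵥ g =
0`. -/
theorem colsIndep_of_exists_eqOn {X : Type*} [Fintype X] {V : Submodule ℝ (X → ℝ)} {T : Set X}
    (h : ∀ y : X → ℝ, ∃ f ∈ V, ∀ x ∈ T, f x = y x) : ColsIndep V T := by
  refine colsIndep_iff_perp.2 fun g hg h0 => ?_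
  obtain ⟨f, hf, hfg⟩ := h g
  have : f ⬝ᵥ g = g ⬝ᵥ g := Finset.sum_congr rfl fun x _ => by
    by_cases hx : x ∈ T
    · rw [hfg x hx]
    · rw [h0 x hx, mul_zero, mul_zero]
  rw [hg f hf] at this
  exact dotProduct_self_eq_zero.1 this.symm

/-! ### Linear systems with generic coefficients -/

/-- The linear system `f (u i) - θ (a i) * f (w i)`, where the coefficient is zero if `a i` is
`none`. -/
def sysMap {X ι σ : Type*} (u w : ι → X) (a : ι → Option σ) (θ : σ → ℝ) :
    (X → ℝ) →ₗ[ℝ] (ι → ℝ) where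
  toFun f i := f (u i) - (a i).elim 0 θ * f (w i)
  map_add' f g := by funext i; simp only [Pi.add_apply]; ring
  map_smul' c f := by funext i; simp only [Pi.smul_apply, smul_eq_mul, RingHom.id_apply]; ring

theorem sysMap_apply {X ι σ : Type*} (u w : ι → X) (a : ι → Option σ) (θ : σ → ℝ) (f : X → ℝ)
    (i : ι) : sysMap u w a θ f i = f (u i) - (a i).elim 0 θ * f (w i) := rfl

open MvPolynomial in
/-- If a linear system has only the trivial solution in a vector space over `ℚ` for some values of
its coefficients, then so it has for algebraically independent values. -/
theorem IsOverRat.sysMap_ker {X ι σ : Type*} [Finite X] [Fintype ι] {V : Submodule ℝ (X → ℝ)}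
    (hV : IsOverRat V) {u w : ι → X} {a : ι → Option σ} {θ₀ θ : σ → ℝ}
    (hθ : AlgebraicIndependent ℚ θ) (h₀ : ∀ f ∈ V, sysMap u w a θ₀ f = 0 → f = 0) :
    ∀ f ∈ V, sysMap u w a θ f = 0 → f = 0 := by
  classical
  obtain ⟨m, K, hK⟩ := hV
  set M : Matrix (Fin m) X ℝ := K.map (fun q : ℚ => (q : ℝ)) with hM
  let N : Matrix ι (Fin m) (MvPolynomial σ ℚ) :=
    Matrix.of fun i k => C (K k (u i)) - (a i).elim 0 MvPolynomial.X * C (K k (w i))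
  -- The system need not be square here; over `ℝ` the Gram determinant is nonzero exactly when the
  -- kernel is trivial.
  let p : MvPolynomial σ ℚ := (N.transpose * N).det
  have hN : ∀ (η : σ → ℝ) (c : Fin m → ℝ),
      (N.map (aeval η)).mulVec c = sysMap u w a η (∑ k, c k • M.row k) := by
    intro η c
    funext i
    have hai : aeval η ((a i).elim 0 MvPolynomial.X : MvPolynomial σ ℚ) = (a i).elim 0 η := by
      cases a i <;> simp
    simp only [Matrix.mulVec, dotProduct, Matrix.map_apply, N, Matrix.of_apply, map_sub, map_mul,
      hai, aeval_C, sysMap_apply, Finset.sum_apply, Pi.smul_apply, smul_eq_mul, Finset.mul_sum,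
      ← Finset.sum_sub_distrib, eq_ratCast, hM, Matrix.row]
    exact Finset.sum_congr rfl fun k _ => by ring
  have hp : ∀ η : σ → ℝ,
      aeval η p ≠ 0 ↔ ∀ c : Fin m → ℝ, (N.map (aeval η)).mulVec c = 0 → c = 0 := by
    intro η
    have hdet : aeval η p = ((N.map (aeval η)).transpose * N.map (aeval η)).det := by
      rw [AlgHom.map_det, AlgHom.mapMatrix_apply, Matrix.map_mul, Matrix.transpose_map]
    have hker := Matrix.ker_mulVecLin_transpose_mul_self (N.map (aeval η))
    have hiff : ∀ c : Fin m → ℝ, ((N.map (aeval η)).transpose * N.map (aeval η)).mulVec c = 0 ↔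
        (N.map (aeval η)).mulVec c = 0 := fun c => by
      simpa only [LinearMap.mem_ker, Matrix.mulVecLin_apply] using SetLike.ext_iff.1 hker c
    rw [hdet, ne_eq, ← Matrix.exists_mulVec_eq_zero_iff]
    simp only [hiff, ne_eq]
    push Not
    exact forall_congr' fun c => ⟨fun h hc => by_contra fun hne => h hne hc,
      fun h hne hc => hne (h hc)⟩
  have hmem : ∀ c : Fin m → ℝ, ∑ k, c k • M.row k ∈ V := fun c => by
    rw [← hK.2]
    exact Submodule.sum_mem _ fun k _ =>
      Submodule.smul_mem _ _ (Submodule.subset_span ⟨k, rfl⟩)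
  have hp0 : aeval θ₀ p ≠ 0 := (hp θ₀).2 fun c hc => by
    rw [hN] at hc
    exact funext (Fintype.linearIndependent_iff.1 hK.1 c (h₀ _ (hmem c) hc))
  -- The value at `θ₀` shows that `p` is not the zero polynomial, so it cannot vanish at
  -- algebraically independent values.
  have hpθ : aeval θ p ≠ 0 := fun h => hp0 (by
    rw [(injective_iff_map_eq_zero _).1 hθ p h, map_zero])
  intro f hf hf0
  rw [← hK.2, Submodule.mem_span_range_iff_exists_fun] at hf
  obtain ⟨c, rfl⟩ := hf
  rw [← hN] at hf0
  simp [(hp θ).1 hpθ c hf0]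

/-! ### Hybrid representations -/

section Hybrid

variable {P : Type*} [Fintype P] {A : AffineSubspace ℝ (Var P → ℝ)} {T : Set P}
  {G : (P → ℝ) →ₗ[ℝ] (Var P → ℝ)} {h : Var P → ℝ}

theorem forall_mem_complCols {Q : Type*} {T : Set Q} {p : Var Q → Prop} :
    (∀ x ∈ complCols T, p x) ↔ ∀ q, p (selVar T q) := by
  refine ⟨fun h q => h _ (selVar_mem T q), fun h x hx => ?_⟩
  rcases x with q | q
  · have := h q
    rwa [selVar, if_pos (mem_complCols_volt.1 hx)] at this
  · have := h q
    rwa [selVar, if_neg (mem_complCols_curr.1 hx)] at this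

/-- An affine space that is parametrized by its coordinates in `complCols T` has `complCols T` as a
column base. -/
theorem isColBase_direction (hA : ∀ f, f ∈ A ↔ f = G (fun p => f (selVar T p)) + h)
    (hG : ∀ y p, G y (selVar T p) = y p) (hh : ∀ p, h (selVar T p) = 0) :
    IsColBase A.direction (complCols T) := by
  have hhA : h ∈ A := (hA h).2 (by
    rw [show (fun p => h (selVar T p)) = 0 from funext hh, map_zero, zero_add])
  have hdir : ∀ d, d ∈ A.direction ↔ d = G fun p => d (selVar T p) := fun d => by
    rw [← AffineSubspace.vadd_mem_iff_mem_direction d hhA, hA]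
    simp only [vadd_eq_add, Pi.add_apply, hh, add_zero, add_left_inj]
  refine isColBase_iff.2 ⟨colsIndep_of_exists_eqOn fun y => ?_, fun d hd h0 => ?_⟩
  · refine ⟨G fun p => y (selVar T p), (hdir _).2 ?_, forall_mem_complCols.2 fun p => hG _ p⟩
    simp only [hG]
  · rw [(hdir d).1 hd, show (fun p => d (selVar T p)) = 0 from
      funext (forall_mem_complCols.1 h0), map_zero]

/-- The matrices are the blocks of `G` on unit vectors, with inputs and outputs split by membership
in `T`. -/
theorem hasHybridRep (hA : ∀ f, f ∈ A ↔ f = G (fun p => f (selVar T p)) + h)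
    (hG : ∀ y p, G y (selVar T p) = y p) (hh : ∀ p, h (selVar T p) = 0) :
    HasHybridRep A T := by
  classical
  have hsum : ∀ (y : P → ℝ) (x : Var P), G y x =
      ∑ q : {q // q ∈ T}, G (Pi.single q.1 1) x * y q +
        ∑ q : {q // q ∉ T}, G (Pi.single q.1 1) x * y q := fun y x => by
    rw [Fintype.sum_subtype_add_sum_subtype (· ∈ T) fun q => G (Pi.single q 1) x * y q,
      LinearMap.pi_apply_eq_sum_univ G y]
    simp only [Finset.sum_apply, Pi.smul_apply, smul_eq_mul]
    refine Finset.sum_congr rfl fun q _ => ?_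
    rw [mul_comm]
    rw [show (fun j => if q = j then (1 : ℝ) else 0) = Pi.single q 1 from
      funext fun j => by simp [Pi.single_apply, eq_comm]]
  refine ⟨Matrix.of fun p q => G (Pi.single q.1 1) (curr p.1),
    Matrix.of fun p q => G (Pi.single q.1 1) (curr p.1),
    Matrix.of fun p q => G (Pi.single q.1 1) (volt p.1),
    Matrix.of fun p q => G (Pi.single q.1 1) (volt p.1),
    fun p => h (curr p.1), fun p => h (volt p.1), fun f => ?_⟩
  have h1 : ∀ q : {q // q ∈ T}, f (selVar T q) = f (volt q.1) := fun q => by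
    rw [selVar, if_pos q.2]
  have h2 : ∀ q : {q // q ∉ T}, f (selVar T q) = f (curr q.1) := fun q => by
    rw [selVar, if_neg q.2]
  have key : ∀ x, (G (fun p => f (selVar T p)) + h) x =
      ∑ q : {q // q ∈ T}, G (Pi.single q.1 1) x * f (volt q.1) +
        ∑ q : {q // q ∉ T}, G (Pi.single q.1 1) x * f (curr q.1) + h x := fun x => by
    rw [Pi.add_apply, hsum]
    simp only [h1, h2]
  rw [hA]
  constructor
  · intro hf
    exact ⟨funext fun p => (congrFun hf (curr p.1)).trans (by
        rw [key]; simp only [Pi.add_apply, Matrix.mulVec, dotProduct, Matrix.of_apply]),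
      funext fun p => (congrFun hf (volt p.1)).trans (by
        rw [key]; simp only [Pi.add_apply, Matrix.mulVec, dotProduct, Matrix.of_apply])⟩
  · rintro ⟨hc, hv⟩
    -- The selected coordinates satisfy `f = G y + h` automatically; only the two hybrid equations
    -- carry content.
    have hsel : ∀ p, f (selVar T p) = (G (fun p => f (selVar T p)) + h) (selVar T p) := fun p => by
      rw [Pi.add_apply, hG, hh, add_zero]
    funext x
    rcases x with p | p <;> by_cases hp : p ∈ T
    · simpa only [selVar, if_pos hp] using hsel p
    · refine (congrFun hv ⟨p, hp⟩).trans ?_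
      rw [key]; simp only [Pi.add_apply, Matrix.mulVec, dotProduct, Matrix.of_apply]
    · refine (congrFun hc ⟨p, hp⟩).trans ?_
      rw [key]; simp only [Pi.add_apply, Matrix.mulVec, dotProduct, Matrix.of_apply]
    · simpa only [selVar, if_neg hp] using hsel p

end Hybrid

/-! ### The equations of the devices -/

section Devices

variable {κ₁ κ₂ κ₃ κ₄ ρ ε ι P : Type*}

namespace DevEdge

/-- The variable that is determined by the equation of a device edge. -/
def mainVar : DevEdge κ₁ κ₂ κ₃ κ₄ ρ ε ι → Var (DevEdge κ₁ κ₂ κ₃ κ₄ ρ ε ι)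
  | ccvsY k => volt (ccvsY k)
  | ccvsZ k => volt (ccvsZ k)
  | vccsY k => curr (vccsY k)
  | vccsZ k => curr (vccsZ k)
  | cccsY k => volt (cccsY k)
  | cccsZ k => curr (cccsZ k)
  | vcvsY k => curr (vcvsY k)
  | vcvsZ k => volt (vcvsZ k)
  | res k => volt (res k)
  | vsrc k => volt (vsrc k)
  | isrc k => curr (isrc k)

/-- The variable that controls the main variable of a device edge. -/
def ctrlVar : DevEdge κ₁ κ₂ κ₃ κ₄ ρ ε ι → Var (DevEdge κ₁ κ₂ κ₃ κ₄ ρ ε ι)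
  | ccvsZ k => curr (ccvsY k)
  | vccsZ k => volt (vccsY k)
  | cccsZ k => curr (cccsY k)
  | vcvsZ k => volt (vcvsY k)
  | res k => curr (res k)
  | e => volt e

/-- The parameter of a device edge, if any. -/
def coefIdx : DevEdge κ₁ κ₂ κ₃ κ₄ ρ ε ι → Option (κ₁ ⊕ κ₂ ⊕ κ₃ ⊕ κ₄ ⊕ ρ)
  | ccvsZ k => some (.inl k)
  | vccsZ k => some (.inr (.inl k))
  | cccsZ k => some (.inr (.inr (.inl k)))
  | vcvsZ k => some (.inr (.inr (.inr (.inl k))))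
  | res k => some (.inr (.inr (.inr (.inr k))))
  | _ => none

end DevEdge

open DevEdge

/-- The right-hand sides of the device equations. -/
def DevData.source (D : DevData κ₁ κ₂ κ₃ κ₄ ρ ε ι) : DevEdge κ₁ κ₂ κ₃ κ₄ ρ ε ι → ℝ
  | vsrc k => D.sE k
  | isrc k => D.sJ k
  | _ => 0

/-- The homogeneous part of the device equations. -/
def DevData.devMap (D : DevData κ₁ κ₂ κ₃ κ₄ ρ ε ι) :
    (Var (DevEdge κ₁ κ₂ κ₃ κ₄ ρ ε ι) → ℝ) →ₗ[ℝ] (DevEdge κ₁ κ₂ κ₃ κ₄ ρ ε ι → ℝ) :=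
  sysMap mainVar ctrlVar coefIdx D.param

theorem DevData.mem_characteristic {D : DevData κ₁ κ₂ κ₃ κ₄ ρ ε ι}
    {x : Var (DevEdge κ₁ κ₂ κ₃ κ₄ ρ ε ι) → ℝ} :
    x ∈ D.characteristic ↔ D.devMap x = D.source := by
  have key : D.devMap x = D.source ↔ ∀ e,
      x (mainVar e) - (coefIdx e).elim 0 D.param * x (ctrlVar e) = D.source e := funext_iff
  rw [key]
  constructor
  · rintro ⟨h1, h2, h3, h4, h5, h6, h7⟩ e
    cases e <;>
      simp [mainVar, ctrlVar, coefIdx, source, param, h1, h2, h3, h4, h5, h6, h7]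
  · intro h
    refine ⟨fun k => ⟨?_, ?_⟩, fun k => ⟨?_, ?_⟩, fun k => ⟨?_, ?_⟩, fun k => ⟨?_, ?_⟩,
      fun k => ?_, fun k => ?_, fun k => ?_⟩
    · simpa [mainVar, ctrlVar, coefIdx, source, param] using h (ccvsY k)
    · simpa [mainVar, ctrlVar, coefIdx, source, param, sub_eq_zero] using h (ccvsZ k)
    · simpa [mainVar, ctrlVar, coefIdx, source, param] using h (vccsY k)
    · simpa [mainVar, ctrlVar, coefIdx, source, param, sub_eq_zero] using h (vccsZ k)
    · simpa [mainVar, ctrlVar, coefIdx, source, param] using h (cccsY k)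
    · simpa [mainVar, ctrlVar, coefIdx, source, param, sub_eq_zero] using h (cccsZ k)
    · simpa [mainVar, ctrlVar, coefIdx, source, param] using h (vcvsY k)
    · simpa [mainVar, ctrlVar, coefIdx, source, param, sub_eq_zero] using h (vcvsZ k)
    · simpa [mainVar, ctrlVar, coefIdx, source, param, sub_eq_zero] using h (res k)
    · simpa [mainVar, ctrlVar, coefIdx, source, param] using h (vsrc k)
    · simpa [mainVar, ctrlVar, coefIdx, source, param] using h (isrc k)

/-- This inclusion needs no solution of the device equations, whereas `DevData.mem_direction` does,
since an empty affine space has zero direction. -/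
theorem DevData.direction_le_ker (D : DevData κ₁ κ₂ κ₃ κ₄ ρ ε ι) :
    D.characteristic.direction ≤ LinearMap.ker D.devMap := by
  refine Submodule.span_le.2 ?_
  rintro _ ⟨x, hx, y, hy, rfl⟩
  simp only [SetLike.mem_coe, LinearMap.mem_ker, vsub_eq_sub, map_sub]
  rw [mem_characteristic.1 hx, mem_characteristic.1 hy, sub_self]

theorem DevData.mem_direction {D : DevData κ₁ κ₂ κ₃ κ₄ ρ ε ι}
    {x₀ d : Var (DevEdge κ₁ κ₂ κ₃ κ₄ ρ ε ι) → ℝ} (hx₀ : D.devMap x₀ = D.source) :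
    d ∈ D.characteristic.direction ↔ D.devMap d = 0 := by
  rw [← AffineSubspace.vadd_mem_iff_mem_direction d (mem_characteristic.2 hx₀),
    mem_characteristic, vadd_eq_add, map_add, hx₀, add_eq_right]

theorem DevData.mem_portBehaviour {D : DevData κ₁ κ₂ κ₃ κ₄ ρ ε ι}
    {V : Submodule ℝ (Var (DevEdge κ₁ κ₂ κ₃ κ₄ ρ ε ι ⊕ P) → ℝ)} {f : Var P → ℝ} :
    f ∈ (GenMultiport.mk V D.characteristic).portBehaviour ↔
      ∃ x ∈ V, D.devMap (x ∘ devVar) = D.source ∧ x ∘ portVar = f := by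
  constructor
  · rintro ⟨x, ⟨hx, hd⟩, rfl⟩
    exact ⟨x, hx, mem_characteristic.1 hd, rfl⟩
  · rintro ⟨x, hx, hd, rfl⟩
    exact ⟨x, ⟨hx, mem_characteristic.2 hd⟩, rfl⟩

theorem volt_eq_zero_of_mem_ker {D : DevData κ₁ κ₂ κ₃ κ₄ ρ ε ι}
    {d : Var (DevEdge κ₁ κ₂ κ₃ κ₄ ρ ε ι) → ℝ} (hd : D.devMap d = 0)
    {e : DevEdge κ₁ κ₂ κ₃ κ₄ ρ ε ι} (he : e ∈ DevEdge.Y₁ ∪ DevEdge.E) : d (volt e) = 0 := by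
  have h := congrFun hd e
  rcases he with (⟨k, rfl⟩ | ⟨k, rfl⟩) | ⟨k, rfl⟩ <;>
    simpa [DevData.devMap, sysMap_apply, mainVar, coefIdx] using h

theorem curr_eq_zero_of_mem_ker {D : DevData κ₁ κ₂ κ₃ κ₄ ρ ε ι}
    {d : Var (DevEdge κ₁ κ₂ κ₃ κ₄ ρ ε ι) → ℝ} (hd : D.devMap d = 0)
    {e : DevEdge κ₁ κ₂ κ₃ κ₄ ρ ε ι} (he : e ∈ DevEdge.Y₂ ∪ DevEdge.J) : d (curr e) = 0 := by
  have h := congrFun hd e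
  rcases he with (⟨k, rfl⟩ | ⟨k, rfl⟩) | ⟨k, rfl⟩ <;>
    simpa [DevData.devMap, sysMap_apply, mainVar, coefIdx] using h

/-- No edge is both a prescribed-voltage and a prescribed-current edge. -/
theorem disjoint_sources : Disjoint (DevEdge.Z₁ ∪ DevEdge.Y₁ ∪ DevEdge.E)
    (DevEdge.Z₂ ∪ DevEdge.Y₂ ∪ DevEdge.J : Set (DevEdge κ₁ κ₂ κ₃ κ₄ ρ ε ι)) := by
  rw [Set.disjoint_left]
  rintro _ (((⟨k, rfl⟩ | ⟨k, rfl⟩) | (⟨k, rfl⟩ | ⟨k, rfl⟩)) | ⟨k, rfl⟩) <;>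
    simp [Z₂, Y₂, J]

/-! ### The network equations -/

/-- The device equations together with the values on the port variables in `complCols T`. -/
noncomputable def DevData.netMap (T : Set (DevEdge κ₁ κ₂ κ₃ κ₄ ρ ε ι ⊕ P))
    (θ : κ₁ ⊕ κ₂ ⊕ κ₃ ⊕ κ₄ ⊕ ρ → ℝ) :
    (Var (DevEdge κ₁ κ₂ κ₃ κ₄ ρ ε ι ⊕ P) → ℝ) →ₗ[ℝ]
      (DevEdge κ₁ κ₂ κ₃ κ₄ ρ ε ι ⊕ P → ℝ) :=
  sysMap (Sum.elim (devVar ∘ mainVar) (selVar T ∘ Sum.inr))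
    (Sum.elim (devVar ∘ ctrlVar) (selVar T ∘ Sum.inr)) (Sum.elim coefIdx fun _ => none) θ

theorem DevData.netMap_eq (D : DevData κ₁ κ₂ κ₃ κ₄ ρ ε ι)
    (T : Set (DevEdge κ₁ κ₂ κ₃ κ₄ ρ ε ι ⊕ P))
    (f : Var (DevEdge κ₁ κ₂ κ₃ κ₄ ρ ε ι ⊕ P) → ℝ) :
    netMap T D.param f =
      Sum.elim (D.devMap (f ∘ devVar)) fun p => f (selVar T (Sum.inr p)) := by
  funext q
  rcases q with e | p
  · rfl
  · simp [netMap, sysMap_apply]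

variable {V : Submodule ℝ (Var (DevEdge κ₁ κ₂ κ₃ κ₄ ρ ε ι ⊕ P) → ℝ)}
  {T : Set (DevEdge κ₁ κ₂ κ₃ κ₄ ρ ε ι ⊕ P)}
  {D : DevData κ₁ κ₂ κ₃ κ₄ ρ ε ι}
  {φ : V ≃ₗ[ℝ] (DevEdge κ₁ κ₂ κ₃ κ₄ ρ ε ι ⊕ P → ℝ)}

/-- If the network equations are uniquely solvable, then the multiport is rigid. -/
theorem isRigid_of_netEquiv
    (hφ : ∀ f : V, φ f =
      Sum.elim (D.devMap ((f : Var (DevEdge κ₁ κ₂ κ₃ κ₄ ρ ε ι ⊕ P) → ℝ) ∘ devVar))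
        fun p => f.1 (selVar T (Sum.inr p))) :
    (GenMultiport.mk V D.characteristic).IsRigid := by
  have hdev : ∀ y, D.devMap ((φ.symm y).1 ∘ devVar) = y ∘ Sum.inl := fun y => by
    have := hφ (φ.symm y)
    rw [LinearEquiv.apply_symm_apply] at this
    conv_rhs => rw [this]
    rfl
  have hdir : ∀ d, d ∈ D.characteristic.direction ↔ D.devMap d = 0 := fun d =>
    DevData.mem_direction (hdev (Sum.elim D.source 0))
  constructor
  -- Subtract from `y` a vector of `V` with the same image under the device equations; its selected
  -- port values are set to zero.
  · refine eq_top_iff.2 fun y _ => Submodule.mem_sup.2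
      ⟨_, ⟨_, (φ.symm (Sum.elim (D.devMap y) 0)).2, rfl⟩, y - _, (hdir _).2 ?_,
        add_sub_cancel _ _⟩
    rw [map_sub, sub_eq_zero]
    exact (hdev (Sum.elim (D.devMap y) 0)).symm
  · refine (Submodule.eq_bot_iff _).2 ?_
    rintro d ⟨⟨f, hf, h0, hfd⟩, hd⟩
    -- The vector `f` vanishes on all port variables and solves the homogeneous device equations.
    have hf0 : φ ⟨f, hf⟩ = 0 := by
      rw [hφ, show f ∘ devVar = d from funext hfd, (hdir d).1 hd]
      funext q
      rcases q with e | p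
      · rfl
      · refine h0 _ ?_
        rw [selVar]
        rintro ⟨y | y, hy⟩ <;> split_ifs at hy <;> simp [devVar] at hy
    have : f = 0 := congrArg Subtype.val (φ.map_eq_zero_iff.1 hf0)
    funext y
    rw [← hfd, this]
    rfl

theorem portVar_selVar (p : P) :
    (portVar (selVar (Sum.inr ⁻¹' T) p) : Var (DevEdge κ₁ κ₂ κ₃ κ₄ ρ ε ι ⊕ P)) =
      selVar T (Sum.inr p) := by
  by_cases hp : Sum.inr p ∈ T
  · rw [selVar, selVar, if_pos hp, if_pos (by exact hp)]; rfl
  · rw [selVar, selVar, if_neg hp, if_neg (by exact hp)]; rfl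

/-- If the network equations are uniquely solvable, then the values on the port variables in
`complCols T` parametrize the port behaviour. -/
theorem portBehaviour_of_netEquiv [Fintype P]
    (hφ : ∀ f : V, φ f =
      Sum.elim (D.devMap ((f : Var (DevEdge κ₁ κ₂ κ₃ κ₄ ρ ε ι ⊕ P) → ℝ) ∘ devVar))
        fun p => f.1 (selVar T (Sum.inr p))) :
    IsColBase (GenMultiport.mk V D.characteristic).portBehaviour.direction
        (portVar ⁻¹' complCols T) ∧
      HasHybridRep (GenMultiport.mk V D.characteristic).portBehaviour
        {p | volt (Sum.inr p) ∈ complCols T} := by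
  have h1 : (portVar ⁻¹' complCols T : Set (Var P)) = complCols (Sum.inr ⁻¹' T) := by
    ext x
    rcases x with p | p
    · exact mem_complCols_volt.trans (mem_complCols_volt (T := Sum.inr ⁻¹' T)).symm
    · exact mem_complCols_curr.trans (mem_complCols_curr (T := Sum.inr ⁻¹' T)).symm
  have h2 : {p | volt (Sum.inr p) ∈ complCols T} = (Sum.inr ⁻¹' T : Set P) := by
    ext p
    exact mem_complCols_volt
  rw [h1, h2]
  let inc : (P → ℝ) →ₗ[ℝ] (DevEdge κ₁ κ₂ κ₃ κ₄ ρ ε ι ⊕ P → ℝ) :=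
    { toFun := fun y => Sum.elim 0 y
      map_add' := fun y z => by funext q; rcases q with e | p <;> simp
      map_smul' := fun c y => by funext q; rcases q with e | p <;> simp }
  let port : V →ₗ[ℝ] (Var P → ℝ) := LinearMap.funLeft ℝ ℝ portVar ∘ₗ V.subtype
  -- Superposition: `G` is the response to port values without sources, `h` the response to the
  -- sources with zero port values.
  let G : (P → ℝ) →ₗ[ℝ] (Var P → ℝ) := port ∘ₗ φ.symm.toLinearMap ∘ₗ inc
  let h : Var P → ℝ := port (φ.symm (Sum.elim D.source 0))
  have hport : ∀ y p, port (φ.symm y) (selVar (Sum.inr ⁻¹' T) p) = y (Sum.inr p) := fun y p => by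
    have := congrFun (hφ (φ.symm y)) (Sum.inr p)
    rw [LinearEquiv.apply_symm_apply] at this
    rw [this]
    exact congrArg (φ.symm y).1 (portVar_selVar p)
  have hGh : ∀ y, G y + h = port (φ.symm (Sum.elim D.source y)) := fun y => by
    rw [show Sum.elim D.source y = inc y + Sum.elim D.source 0 by
      funext q; rcases q with e | p <;> simp [inc], map_add, map_add]
    rfl
  have hA : ∀ f, f ∈ (GenMultiport.mk V D.characteristic).portBehaviour ↔
      f = G (fun p => f (selVar (Sum.inr ⁻¹' T) p)) + h := fun f => by
    rw [DevData.mem_portBehaviour, hGh]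
    constructor
    · rintro ⟨x, hx, hxs, rfl⟩
      have : Sum.elim D.source (fun p => (x ∘ portVar) (selVar (Sum.inr ⁻¹' T) p)) =
          φ ⟨x, hx⟩ := by
        rw [hφ, hxs]
        simp only [Function.comp_apply, portVar_selVar]
      rw [this, LinearEquiv.symm_apply_apply]
      rfl
    · intro hf
      refine ⟨_, (φ.symm _).2, ?_, hf.symm⟩
      have := hφ (φ.symm (Sum.elim D.source fun p => f (selVar (Sum.inr ⁻¹' T) p)))
      rw [LinearEquiv.apply_symm_apply] at this
      exact funext fun e => (congrFun this (Sum.inl e)).symm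
  exact ⟨isColBase_direction hA (fun y p => hport _ p) fun p => hport _ p,
    hasHybridRep hA (fun y p => hport _ p) fun p => hport _ p⟩

/-! ### Multiports with generic parameters -/

variable [Fintype κ₁] [Fintype κ₂] [Fintype κ₃] [Fintype κ₄] [Fintype ρ] [Fintype ε] [Fintype ι]
  [Fintype P]

/-- The full sum property forces the controlling and source columns to be independent. -/
theorem colsIndep_of_fullSum (D : DevData κ₁ κ₂ κ₃ κ₄ ρ ε ι)
    (V : Submodule ℝ (Var (DevEdge κ₁ κ₂ κ₃ κ₄ ρ ε ι ⊕ P) → ℝ))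
    (h : (GenMultiport.mk V D.characteristic).FullSum) :
    ColsIndep V (volt '' (Sum.inl '' (DevEdge.Y₁ ∪ DevEdge.E)) ∪
      curr '' (Sum.inl '' (DevEdge.Y₂ ∪ DevEdge.J))) := by
  refine colsIndep_of_exists_eqOn fun y => ?_
  have hy : y ∘ devVar ∈ restrict devVar V ⊔ D.characteristic.direction := by
    rw [show restrict devVar V ⊔ D.characteristic.direction = ⊤ from h]
    trivial
  obtain ⟨_, ⟨f, hf, rfl⟩, d, hd, hfd⟩ := Submodule.mem_sup.1 hy
  replace hd := D.direction_le_ker hd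
  refine ⟨f, hf, ?_⟩
  rintro _ (⟨_, ⟨e, he, rfl⟩, rfl⟩ | ⟨_, ⟨e, he, rfl⟩, rfl⟩)
  · have := congrFun hfd (volt e)
    rwa [Pi.add_apply, volt_eq_zero_of_mem_ker hd he, add_zero] at this
  · have := congrFun hfd (curr e)
    rwa [Pi.add_apply, curr_eq_zero_of_mem_ker hd he, add_zero] at this

/-- The base and the cobase in (a) may be unrelated. Extending the independent set inside the
spanning complement of the second set yields a single base meeting both requirements. -/
theorem CondA.exists_isColBase {V : Submodule ℝ (Var (DevEdge κ₁ κ₂ κ₃ κ₄ ρ ε ι ⊕ P) → ℝ)}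
    (hV : IsDirac V) (h : CondA V) : ∃ T, IsColBase V (complCols T) ∧
      volt '' (Sum.inl '' (DevEdge.Z₁ ∪ DevEdge.Y₁ ∪ DevEdge.E)) ∪
        curr '' (Sum.inl '' (DevEdge.Z₂ ∪ DevEdge.Y₂ ∪ DevEdge.J)) ⊆ complCols T := by
  obtain ⟨⟨b, hb, hAb⟩, hB⟩ := h
  obtain ⟨T, hT, hAT, hTB⟩ := (hb.1.mono hAb).exists_isColBase
    (Set.subset_compl_iff_disjoint_right.2
      ((Set.disjoint_image_iff Sum.inl_injective).2 disjoint_sources))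
    (fun f hf h0 => exists_isColCobase_iff.1 hB f hf h0)
  exact ⟨T, hV.isColBase_of_volt hT, Set.union_subset_union (Set.image_mono hAT)
    (Set.image_mono (Set.subset_compl_comm.1 hTB))⟩

theorem CondB.exists_isColBase {V : Submodule ℝ (Var (DevEdge κ₁ κ₂ κ₃ κ₄ ρ ε ι ⊕ P) → ℝ)}
    (hV : IsDirac V) (h : CondB V) : ∃ T, IsColBase V (complCols T) ∧
      volt '' (Sum.inl '' (DevEdge.Z₁ ∪ DevEdge.Y₁ ∪ DevEdge.E)) ∪
        curr '' (Sum.inl '' (DevEdge.Z₂ ∪ DevEdge.Y₂ ∪ DevEdge.J)) ⊆ complCols T := by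
  obtain ⟨⟨b, hb, hBb⟩, hA⟩ := h
  obtain ⟨U, hU, hBU, hUA⟩ := (hb.1.mono hBb).exists_isColBase
    (Set.subset_compl_iff_disjoint_right.2
      ((Set.disjoint_image_iff Sum.inl_injective).2 disjoint_sources.symm))
    (fun f hf h0 => exists_isColCobase_iff.1 hA f hf h0)
  -- The base `U` consists of current columns, so the voltage columns are indexed by its complement.
  refine ⟨Uᶜ, hV.isColBase_of_curr (by rwa [compl_compl]), Set.union_subset_union
    (Set.image_mono (Set.subset_compl_comm.1 hUA)) (Set.image_mono ?_)⟩
  rwa [compl_compl]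

/-- If the controlled sources are switched off and all resistances are `1`, then the network
equations have only the trivial solution. -/
theorem netMap_special_ker (hV : IsDirac V) (hT : IsColBase V (complCols T))
    (hA : ∀ e ∈ DevEdge.Z₁ ∪ DevEdge.Y₁ ∪ DevEdge.E, Sum.inl e ∈ T)
    (hB : ∀ e ∈ DevEdge.Z₂ ∪ DevEdge.Y₂ ∪ DevEdge.J, Sum.inl e ∉ T) :
    ∀ f ∈ V, DevData.netMap T
      (Sum.elim 0 (Sum.elim 0 (Sum.elim 0 (Sum.elim 0 (1 : ρ → ℝ))))) f = 0 → f = 0 := by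
  intro f hf h0
  have hsel : ∀ q, f (selVar T q) = 0 → f (volt q) * f (curr q) = 0 := fun q h => by
    by_cases hq : q ∈ T
    · rw [selVar, if_pos hq] at h
      rw [h, zero_mul]
    · rw [selVar, if_neg hq] at h
      rw [h, mul_zero]
  have hport : ∀ p, f (selVar T (Sum.inr p)) = 0 := fun p => by
    simpa [DevData.netMap, sysMap_apply] using congrFun h0 (Sum.inr p)
  have hdev : ∀ e : DevEdge κ₁ κ₂ κ₃ κ₄ ρ ε ι, (∀ k, e ≠ res k) →
      f (selVar T (Sum.inl e)) = 0 := by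
    intro e he
    have h := congrFun h0 (Sum.inl e)
    have hA' : e ∈ DevEdge.Z₁ ∪ DevEdge.Y₁ ∪ DevEdge.E →
        selVar T (Sum.inl e) = volt (Sum.inl e) := fun h => if_pos (hA e h)
    have hB' : e ∈ DevEdge.Z₂ ∪ DevEdge.Y₂ ∪ DevEdge.J →
        selVar T (Sum.inl e) = curr (Sum.inl e) := fun h => if_neg (hB e h)
    cases e with
    | res k => exact absurd rfl (he k)
    | _ =>
      first
        | rw [hA' (by simp [Z₁, Y₁, E])]
          simpa [DevData.netMap, sysMap_apply, mainVar, coefIdx, devVar] using h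
        | rw [hB' (by simp [Z₂, Y₂, J])]
          simpa [DevData.netMap, sysMap_apply, mainVar, coefIdx, devVar] using h
  have hres : ∀ k, f (volt (Sum.inl (res k))) = f (curr (Sum.inl (res k))) := fun k => by
    simpa [DevData.netMap, sysMap_apply, mainVar, ctrlVar, coefIdx, devVar, sub_eq_zero]
      using congrFun h0 (Sum.inl (res k))
  -- Off the resistors the selected variable vanishes and so does the power; on a unit resistor the
  -- power is a square.
  have hnn : ∀ q ∈ Finset.univ, 0 ≤ f (volt q) * f (curr q) := by
    rintro (e | p) -
    · by_cases he : ∀ k, e ≠ res k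
      · exact (hsel _ (hdev e he)).ge
      · push Not at he
        obtain ⟨k, rfl⟩ := he
        rw [hres]
        exact mul_self_nonneg _
    · exact (hsel _ (hport p)).ge
  have hz := (Finset.sum_eq_zero_iff_of_nonneg hnn).1 (hV.sum_power hf)
  refine (isColBase_iff.1 hT).2 f hf (forall_mem_complCols.2 ?_)
  rintro (e | p)
  · by_cases he : ∀ k, e ≠ res k
    · exact hdev e he
    · push Not at he
      obtain ⟨k, rfl⟩ := he
      -- `T` may select either variable of a resistor; zero power makes both vanish.
      have h1 := hz (Sum.inl (res k)) (Finset.mem_univ _)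
      rw [hres, mul_self_eq_zero] at h1
      rw [selVar]
      split_ifs
      · rw [hres, h1]
      · exact h1
  · exact hport p

/-- Evaluation at the selected variable of each edge identifies `V` with `Q → ℝ`. This makes the
network equations a square system. -/
theorem finrank_of_isColBase {Q : Type*} [Fintype Q] {V : Submodule ℝ (Var Q → ℝ)} {T : Set Q}
    (hT : IsColBase V (complCols T)) : Module.finrank ℝ V = Module.finrank ℝ (Q → ℝ) := by
  classical
  let φ : V →ₗ[ℝ] (Q → ℝ) := LinearMap.funLeft ℝ ℝ (selVar T) ∘ₗ V.subtype
  refine (LinearEquiv.ofBijective φ ⟨(injective_iff_map_eq_zero φ).2 fun f hf => ?_,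
    fun y => ?_⟩).finrank_eq
  · exact Subtype.ext ((isColBase_iff.1 hT).2 f f.2 (forall_mem_complCols.2 (congrFun hf)))
  -- Using `y` for both voltages and currents prescribes `y q` whichever variable of `q` is
  -- selected.
  · obtain ⟨f, hf, hfy⟩ := hT.1.exists_eqOn (Sum.elim y y)
    refine ⟨⟨f, hf⟩, funext fun q => (forall_mem_complCols.1 hfy q).trans ?_⟩
    rw [selVar]
    split_ifs <;> rfl

/-- For generic parameters the network equations are uniquely solvable. -/
theorem exists_netEquiv {D : DevData κ₁ κ₂ κ₃ κ₄ ρ ε ι} (hD : AlgebraicIndependent ℚ D.param)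
    (hV : IsDirac V) (hQ : IsOverRat V) (hT : IsColBase V (complCols T))
    (hsub : volt '' (Sum.inl '' (DevEdge.Z₁ ∪ DevEdge.Y₁ ∪ DevEdge.E)) ∪
        curr '' (Sum.inl '' (DevEdge.Z₂ ∪ DevEdge.Y₂ ∪ DevEdge.J)) ⊆ complCols T) :
    ∃ φ : V ≃ₗ[ℝ] (DevEdge κ₁ κ₂ κ₃ κ₄ ρ ε ι ⊕ P → ℝ), ∀ f : V, φ f =
      Sum.elim (D.devMap ((f : Var (DevEdge κ₁ κ₂ κ₃ κ₄ ρ ε ι ⊕ P) → ℝ) ∘ devVar))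
        fun p => f.1 (selVar T (Sum.inr p)) := by
  let ψ : V →ₗ[ℝ] (DevEdge κ₁ κ₂ κ₃ κ₄ ρ ε ι ⊕ P → ℝ) := DevData.netMap T D.param ∘ₗ V.subtype
  have hker := hQ.sysMap_ker hD (netMap_special_ker hV hT
    (fun e he => mem_complCols_volt.1 (hsub (Or.inl ⟨_, ⟨e, he, rfl⟩, rfl⟩)))
    (fun e he => mem_complCols_curr.1 (hsub (Or.inr ⟨_, ⟨e, he, rfl⟩, rfl⟩))))
  have hinj : Function.Injective ψ := (injective_iff_map_eq_zero ψ).2 fun f hf =>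
    Subtype.ext (hker f f.2 hf)
  have hsurj := (LinearMap.injective_iff_surjective_of_finrank_eq_finrank
    (finrank_of_isColBase hT)).1 hinj
  exact ⟨LinearEquiv.ofBijective ψ ⟨hinj, hsurj⟩, fun f => D.netMap_eq T f⟩

end Devices

end Multiport

theorem mainTheorem10 {κ₁ κ₂ κ₃ κ₄ ρ ε ι P : Type*}
    [Fintype κ₁] [Fintype κ₂] [Fintype κ₃] [Fintype κ₄] [Fintype ρ] [Fintype ε] [Fintype ι]
    [Fintype P]
    (D : DevData κ₁ κ₂ κ₃ κ₄ ρ ε ι)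
    (V : Submodule ℝ (Var (DevEdge κ₁ κ₂ κ₃ κ₄ ρ ε ι ⊕ P) → ℝ))
    (N : GenMultiport (DevEdge κ₁ κ₂ κ₃ κ₄ ρ ε ι) P) (hN : N = ⟨V, D.characteristic⟩)
    (hD : AlgebraicIndependent ℚ D.param) (hV : IsDirac V) :
    -- necessity
    (N.IsRigid →
      ColsIndep V (volt '' (Sum.inl '' (DevEdge.Y₁ ∪ DevEdge.E)) ∪
        curr '' (Sum.inl '' (DevEdge.Y₂ ∪ DevEdge.J)))) ∧
    -- the two forms of the cobase conditions
    ((∃ c, IsColCobase (restrict volt V) c ∧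
        Sum.inl '' (DevEdge.Z₂ ∪ DevEdge.Y₂ ∪ DevEdge.J) ⊆ c) ↔
      ColsIndep (contract curr V) (Sum.inl '' (DevEdge.Z₂ ∪ DevEdge.Y₂ ∪ DevEdge.J))) ∧
    ((∃ c, IsColCobase (restrict curr V) c ∧
        Sum.inl '' (DevEdge.Z₁ ∪ DevEdge.Y₁ ∪ DevEdge.E) ⊆ c) ↔
      ColsIndep (contract volt V) (Sum.inl '' (DevEdge.Z₁ ∪ DevEdge.Y₁ ∪ DevEdge.E))) ∧
    -- sufficiency
    (IsOverRat V → CondA V ∨ CondB V → N.IsRigid) ∧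
    -- existence of a suitable column base
    (CondA V ∨ CondB V → ∃ T, IsColBase V (complCols T) ∧
      volt '' (Sum.inl '' (DevEdge.Z₁ ∪ DevEdge.Y₁ ∪ DevEdge.E)) ∪
        curr '' (Sum.inl '' (DevEdge.Z₂ ∪ DevEdge.Y₂ ∪ DevEdge.J)) ⊆ complCols T) ∧
    -- every such column base gives a hybrid representation of the port behaviour
    (IsOverRat V → CondA V ∨ CondB V → ∀ T, IsColBase V (complCols T) →
      volt '' (Sum.inl '' (DevEdge.Z₁ ∪ DevEdge.Y₁ ∪ DevEdge.E)) ∪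
        curr '' (Sum.inl '' (DevEdge.Z₂ ∪ DevEdge.Y₂ ∪ DevEdge.J)) ⊆ complCols T →
      IsColBase N.portBehaviour.direction (portVar ⁻¹' complCols T) ∧
      HasHybridRep N.portBehaviour {p | volt (Sum.inr p) ∈ complCols T}) := by
  subst hN
  have hex : CondA V ∨ CondB V → _ := fun h =>
    h.elim (CondA.exists_isColBase hV) (CondB.exists_isColBase hV)
  refine ⟨fun h => colsIndep_of_fullSum D V h.1, hV.cobase_volt_iff, hV.cobase_curr_iff,
    fun hQ h => ?_, hex, fun hQ _ T hT hsub => ?_⟩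
  · obtain ⟨T, hT, hsub⟩ := hex h
    obtain ⟨φ, hφ⟩ := exists_netEquiv hD hV hQ hT hsub
    exact isRigid_of_netEquiv hφ
  · obtain ⟨φ, hφ⟩ := exists_netEquiv hD hV hQ hT hsub
    exact portBehaviour_of_netEquiv hφ
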